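/- Let $(\Omega,\mathcal A,\mathbb P)$ be an atomless probability space, let $n\ge 2$, and let $F_1,\dots,F_n$ be probability distributions on $\mathbb R$. All equalities between random variables are understood almost surely. The Fréchet class $\mathcal F_n(F_1,\dots,F_n)$ is the set of distributions of random vectors $(X_1,\dots,X_n)$ on $\Omega$ with $X_i\sim F_i$ for all $i$. A random vector $(X_1,\dots,X_n)$ is counter-monotonic if for all $i\ne j$ there exist increasing (in the non-strict sense) functions $f,g:\mathbb R\to\mathbb R$ and a random variable $Z$ with $X_i=f(Z)$ and $-X_j=g(Z)$; it is a joint mix if $\sum_{i=1}^n X_i$ is a constant. The class supports counter-monotonicity (resp. joint mix dependence) if some counter-monotonic random vector (resp. some joint mix) has its distribution in the class. A distribution is degenerate if it is a point mass $\delta_x$. The class $\mathcal F_n(F_1,\dots,F_n)$ supports both counter-monotonicity and joint mix dependence if and only if at least one of the following two conditions holds: (1) there are $a,m_1,\dots,m_n\in\mathbb R$ and $(p_1,\dots,p_n)\in[0,1]^n$ with $\sum_{i=1}^n p_i=1$ such that $F_i=p_i\delta_{a+m_i}+(1-p_i)\delta_{m_i}$ for all $i$; (2) there are indices $i\neq j$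 and $c\in\mathbb R$ such that $c-X\sim F_j$ whenever $X\sim F_i$, and $F_k$ is degenerate for every $k\notin\{i,j\}$. More precisely, if at least three of $F_1,\dots,F_n$ are non-degenerate, then both are supported if and only if (1) holds; if at most two are non-degenerate, then both are supported if and only if (2) holds. Moreover, if the class supports both counter-monotonicity and joint mix dependence, then every random vector whose distribution lies in the class is counter-monotonic if and only if it is a joint mix. -/

import Mathlib

open MeasureTheory

namespace FrechetClasses

/-- A measure is atomless if every measurable set of positive measure contains a measurable subset
of strictly smaller positive measure. -/
def Atomless {Ω : Type*} [MeasurableSpace Ω] (P : Measure Ω) : Prop :=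
  ∀ A : Set Ω, MeasurableSet A → 0 < P A →
    ∃ B : Set Ω, MeasurableSet B ∧ B ⊆ A ∧ 0 < P B ∧ P B < P A

/-- `(X, Y)` is comonotonic: both are, almost surely, increasing functions of one and the same
random variable `Z`. -/
def Comonotonic {Ω : Type*} [MeasurableSpace Ω] (P : Measure Ω) (X Y : Ω → ℝ) : Prop :=
  ∃ (f g : ℝ → ℝ) (Z : Ω → ℝ), Monotone f ∧ Monotone g ∧ Measurable Z ∧
    (∀ᵐ ω ∂P, X ω = f (Z ω)) ∧ (∀ᵐ ω ∂P, Y ω = g (Z ω))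

/-- `(X, Y)` is counter-monotonic if `(X, -Y)` is comonotonic. -/
def CounterMonotonicPair {Ω : Type*} [MeasurableSpace Ω] (P : Measure Ω) (X Y : Ω → ℝ) : Prop :=
  Comonotonic P X (fun ω => -Y ω)

/-- A random vector is (pairwise) counter-monotonic if each pair of its components is. -/
def CounterMonotonic {Ω : Type*} [MeasurableSpace Ω] (P : Measure Ω) {n : ℕ}
    (X : Ω → Fin n → ℝ) : Prop :=
  ∀ i j : Fin n, i ≠ j → CounterMonotonicPair P (fun ω => X ω i) (fun ω => X ω j)

/-- A random vector is a joint mix if the sum of its components is almost surely a constant. -/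
def JointMix {Ω : Type*} [MeasurableSpace Ω] (P : Measure Ω) {n : ℕ}
    (X : Ω → Fin n → ℝ) : Prop :=
  ∃ c : ℝ, ∀ᵐ ω ∂P, ∑ i, X ω i = c

/-- The Fréchet class of `(F 0, …, F (n - 1))`: the set of the distributions of the random vectors
whose `i`-th component has distribution `F i`. -/
def frechetClass {Ω : Type*} [MeasurableSpace Ω] (P : Measure Ω) {n : ℕ}
    (F : Fin n → Measure ℝ) : Set (Measure (Fin n → ℝ)) :=
  {μ | ∃ X : Ω → Fin n → ℝ, Measurable X ∧ (∀ i, P.map (fun ω => X ω i) = F i) ∧ μ = P.map X}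

/-- The Fréchet class of `F` supports counter-monotonicity. -/
def SupportsCounterMonotonicity {Ω : Type*} [MeasurableSpace Ω] (P : Measure Ω) {n : ℕ}
    (F : Fin n → Measure ℝ) : Prop :=
  ∃ X : Ω → Fin n → ℝ, Measurable X ∧ P.map X ∈ frechetClass P F ∧ CounterMonotonic P X

/-- The Fréchet class of `F` supports joint mix dependence. -/
def SupportsJointMix {Ω : Type*} [MeasurableSpace Ω] (P : Measure Ω) {n : ℕ}
    (F : Fin n → Measure ℝ) : Prop :=
  ∃ X : Ω → Fin n → ℝ, Measurable X ∧ P.map X ∈ frechetClass P F ∧ JointMix P X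

/-- A distribution on `ℝ` is degenerate if it is a point mass. -/
def Degenerate (F : Measure ℝ) : Prop :=
  ∃ x : ℝ, F = Measure.dirac x

/-- Two distributions are symmetric (to each other) if, for some `c`, the distribution of `c - X`
is `G` whenever that of `X` is `F`. -/
def SymmetricPair (F G : Measure ℝ) : Prop :=
  ∃ c : ℝ, F.map (fun x => c - x) = G

/-- `F i = p i • δ_{a + m i} + (1 - p i) • δ_{m i}` for all `i`, with `p` in the standard
simplex. -/
def TwoPointCondition {n : ℕ} (F : Fin n → Measure ℝ) : Prop :=
  ∃ (a : ℝ) (m p : Fin n → ℝ), p ∈ stdSimplex ℝ (Fin n) ∧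
    ∀ i, F i = ENNReal.ofReal (p i) • Measure.dirac (a + m i)
      + ENNReal.ofReal (1 - p i) • Measure.dirac (m i)

/-- Two of the distributions (with distinct indices) are symmetric to each other, and all the
others are degenerate. -/
def SymmetricDegenerateCondition {n : ℕ} (F : Fin n → Measure ℝ) : Prop :=
  ∃ i j : Fin n, i ≠ j ∧ SymmetricPair (F i) (F j) ∧ ∀ k, k ≠ i → k ≠ j → Degenerate (F k)

/-- The number of non-degenerate distributions among `F 0, …, F (n - 1)`. -/
noncomputable def numNondegenerate {n : ℕ} (F : Fin n → Measure ℝ) : ℕ :=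
  Set.ncard {i : Fin n | ¬ Degenerate (F i)}

end FrechetClasses

/-! For a counter-monotonic pair and thresholds `s`, `t`, the events `s < X` and `t < Y` are
disjoint or cover the space (`CounterMonotonicPair.ae_disjoint_or_cover`). With three non-degenerate
components, one disjoint pair of upper events forces all pairs to be disjoint, at all cuts
(`CounterMonotonic.ae_disjoint`). The components are then bounded below and exceed their essential
infima `m i` on disjoint events, so the exceedance probabilities sum to at most one. This bound
concerns the marginals only, so it passes to a joint mix `Y`. There the excesses `Y i - m i` are
nonnegative with constant sum `a ≠ 0`, so some component exceeds its bound; by the bound exactly one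
does, and it takes the whole excess `a` (`twoPointCondition_of_jointMix`). A covering pair is
reduced to a disjoint one by a sign change.

With at most two non-degenerate components, a joint mix amounts to `X i + X j = c`, which gives the
symmetry.

Conversely, two-point marginals reduce to zero-one variables whose means sum to one: both notions
say that exactly one of them equals one. For symmetric marginals both say that `X i + X j` is
constant, since comonotonic variables with equal laws coincide. Atomlessness supplies variables with
prescribed laws. -/

namespace FrechetClasses

open Set Filter Topology

variable {Ω : Type*} [MeasurableSpace Ω] {P : Measure Ω}

/-! ### Atomless spaces carry every distribution -/

/-- Strict inclusion of measurable sets, with strictly increasing measure. -/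
def StrictIncl (P : Measure Ω) (A B : {s : Set Ω // MeasurableSet s}) : Prop :=
  A.1 ⊆ B.1 ∧ P A.1 < P B.1

theorem mem_of_isMaxChain {α : Type*} {r : α → α → Prop} {C : Set α} (hC : IsMaxChain r C) {a : α}
    (h : ∀ b ∈ C, r a b ∨ r b a) : a ∈ C := by
  have h2 := hC.2 (hC.1.insert fun b hb _ => h b hb) (subset_insert a C)
  rw [h2]
  exact mem_insert _ _

theorem subset_of_isChain {C : Set {s : Set Ω // MeasurableSet s}} (hC : IsChain (StrictIncl P) C)
    {A B : {s : Set Ω // MeasurableSet s}} (hA : A ∈ C) (hB : B ∈ C) (h : P A.1 ≤ P B.1) :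
    A.1 ⊆ B.1 := by
  by_cases hAB : A = B
  · rw [hAB]
  · rcases hC hA hB hAB with h1 | h1
    · exact h1.1
    · exact absurd h1.2 (not_lt.2 h)

/-- The union of a maximizing sequence has the supremal measure and is comparable with the whole
chain, so maximality puts it in the chain. -/
theorem exists_greatest_of_isMaxChain {C : Set {s : Set Ω // MeasurableSet s}}
    (hC : IsMaxChain (StrictIncl P) C) {t : ENNReal} (hne : ∃ A ∈ C, P A.1 ≤ t) :
    ∃ A ∈ C, P A.1 ≤ t ∧ ∀ D ∈ C, P D.1 ≤ t → P D.1 ≤ P A.1 := by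
  -- Members of equal measure need not be `StrictIncl`-comparable; denying a greatest one supplies
  -- the strict inequalities.
  by_contra! hcon
  set S : Set ENNReal := {x | ∃ A ∈ C, P A.1 ≤ t ∧ P A.1 = x} with hS
  have hSne : S.Nonempty := by
    obtain ⟨A, hA, hAt⟩ := hne
    exact ⟨_, A, hA, hAt, rfl⟩
  obtain ⟨u, hu, hlim, hmem⟩ := exists_seq_tendsto_sSup hSne (OrderTop.bddAbove S)
  choose A hA hAt hAu using hmem
  have hmono : Monotone fun n => (A n).1 := by
    intro n m hnm
    exact subset_of_isChain hC.1 (hA n) (hA m) (by rw [hAu, hAu]; exact hu hnm)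
  have hPA : P (⋃ n, (A n).1) = sSup S := by
    refine tendsto_nhds_unique (tendsto_measure_iUnion_atTop hmono) ?_
    simpa [Function.comp_def, hAu] using hlim
  have hle : sSup S ≤ t := sSup_le fun x ⟨B, _, hB, hx⟩ => hx ▸ hB
  let B : {s : Set Ω // MeasurableSet s} := ⟨⋃ n, (A n).1, .iUnion fun n => (A n).2⟩
  have hB : B ∈ C := by
    refine mem_of_isMaxChain hC fun D hD => ?_
    rcases le_or_gt (P D.1) t with h | h
    · right
      obtain ⟨D', hD', hD't, hlt⟩ := hcon D hD h
      have hlt' : P D.1 < sSup S := hlt.trans_le (le_sSup ⟨D', hD', hD't, rfl⟩)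
      obtain ⟨n, hn⟩ := (hlim.eventually_const_lt hlt').exists
      refine ⟨(subset_of_isChain hC.1 hD (hA n) (by rw [hAu]; exact hn.le)).trans
        (subset_iUnion (fun n => (A n).1) n), ?_⟩
      change _ < P (⋃ n, (A n).1)
      rwa [hPA]
    · left
      refine ⟨iUnion_subset fun n => subset_of_isChain hC.1 (hA n) hD ((hAt n).trans h.le), ?_⟩
      change P (⋃ n, (A n).1) < _
      rw [hPA]
      exact hle.trans_lt h
  have hPB : P B.1 = sSup S := hPA
  obtain ⟨D, hD, hDt, hlt⟩ := hcon B hB (hPB ▸ hle)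
  have hDS : P D.1 ∈ S := ⟨D, hD, hDt, rfl⟩
  exact absurd (le_sSup hDS) (not_le.2 (hPB ▸ hlt))

theorem exists_least_of_isMaxChain [IsFiniteMeasure P] {C : Set {s : Set Ω // MeasurableSet s}}
    (hC : IsMaxChain (StrictIncl P) C) {t : ENNReal} (hne : ∃ A ∈ C, t ≤ P A.1) :
    ∃ A ∈ C, t ≤ P A.1 ∧ ∀ D ∈ C, t ≤ P D.1 → P A.1 ≤ P D.1 := by
  by_contra! hcon
  set S : Set ENNReal := {x | ∃ A ∈ C, t ≤ P A.1 ∧ P A.1 = x} with hS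
  have hSne : S.Nonempty := by
    obtain ⟨A, hA, hAt⟩ := hne
    exact ⟨_, A, hA, hAt, rfl⟩
  obtain ⟨u, hu, hlim, hmem⟩ := exists_seq_tendsto_sInf hSne (OrderBot.bddBelow S)
  choose A hA hAt hAu using hmem
  have hanti : Antitone fun n => (A n).1 := by
    intro n m hnm
    exact subset_of_isChain hC.1 (hA m) (hA n) (by rw [hAu, hAu]; exact hu hnm)
  have hPA : P (⋂ n, (A n).1) = sInf S := by
    refine tendsto_nhds_unique (tendsto_measure_iInter_atTop
      (fun n => (A n).2.nullMeasurableSet) hanti ⟨0, measure_ne_top _ _⟩) ?_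
    simpa [Function.comp_def, hAu] using hlim
  have hle : t ≤ sInf S := le_sInf fun x ⟨B, _, hB, hx⟩ => hx ▸ hB
  let B : {s : Set Ω // MeasurableSet s} := ⟨⋂ n, (A n).1, .iInter fun n => (A n).2⟩
  have hB : B ∈ C := by
    refine mem_of_isMaxChain hC fun D hD => ?_
    rcases le_or_gt t (P D.1) with h | h
    · left
      obtain ⟨D', hD', hD't, hlt⟩ := hcon D hD h
      have hDS : P D'.1 ∈ S := ⟨D', hD', hD't, rfl⟩
      have hlt' : sInf S < P D.1 := (sInf_le hDS).trans_lt hlt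
      obtain ⟨n, hn⟩ := (hlim.eventually_lt_const hlt').exists
      refine ⟨(iInter_subset (fun n => (A n).1) n).trans
        (subset_of_isChain hC.1 (hA n) hD (by rw [hAu]; exact hn.le)), ?_⟩
      change P (⋂ n, (A n).1) < _
      rwa [hPA]
    · right
      refine ⟨subset_iInter fun n => subset_of_isChain hC.1 hD (hA n) (h.le.trans (hAt n)), ?_⟩
      change _ < P (⋂ n, (A n).1)
      rw [hPA]
      exact h.trans_le hle
  have hPB : P B.1 = sInf S := hPA
  obtain ⟨D, hD, hDt, hlt⟩ := hcon B hB (hPB ▸ hle)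
  have hDS : P D.1 ∈ S := ⟨D, hD, hDt, rfl⟩
  exact absurd (sInf_le hDS) (not_le.2 (hPB ▸ hlt))

/-- In an atomless finite measure space there is an increasing family of measurable sets that
realizes every admissible measure. -/
theorem Atomless.exists_monotone_family [IsProbabilityMeasure P] (hP : Atomless P) :
    ∃ A : unitInterval → Set Ω, Monotone A ∧ (∀ t, MeasurableSet (A t)) ∧
      ∀ t, P (A t) = ENNReal.ofReal t := by
  obtain ⟨C, hC, -⟩ := (IsChain.empty (r := StrictIncl P)).exists_maxChain
  have key : ∀ t : unitInterval, ∃ A ∈ C, P A.1 = ENNReal.ofReal t := by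
    intro t
    have ht0 := t.2.1
    have ht1 := t.2.2
    obtain ⟨A, hA, hAt, hAmax⟩ := exists_greatest_of_isMaxChain hC (t := ENNReal.ofReal t) (by
      by_contra! h
      have h0 : (⟨∅, .empty⟩ : {s : Set Ω // MeasurableSet s}) ∈ C :=
        mem_of_isMaxChain hC fun b hb => .inl ⟨empty_subset _, by
          simpa using (zero_le).trans_lt (h b hb)⟩
      simpa using h _ h0)
    obtain ⟨B, hB, hBt, hBmin⟩ := exists_least_of_isMaxChain hC (t := ENNReal.ofReal t) (by
      by_contra! h
      have h1 : (⟨univ, .univ⟩ : {s : Set Ω // MeasurableSet s}) ∈ C :=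
        mem_of_isMaxChain hC fun b hb => .inr ⟨subset_univ _, by
          simpa using (h b hb).trans_le (by simpa using ht1)⟩
      have := h _ h1
      rw [measure_univ] at this
      exact absurd this (not_lt.2 (by simpa using ht1)))
    rcases hAt.eq_or_lt with h | hAt
    · exact ⟨A, hA, h⟩
    rcases hBt.eq_or_lt with h | hBt
    · exact ⟨B, hB, h.symm⟩
    -- `A` and `B` bound a gap of the chain around `t`. Atomlessness gives a set strictly between
    -- them in measure, which maximality puts in the chain, contradicting the choice of `A` or `B`.
    exfalso
    have hAB := subset_of_isChain hC.1 hA hB (hAt.trans hBt).le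
    have hdiff : P (B.1 \ A.1) = P B.1 - P A.1 :=
      measure_sdiff hAB A.2.nullMeasurableSet (measure_ne_top _ _)
    have hlt := hAt.trans hBt
    obtain ⟨D, hD, hDsub, hD0, hD1⟩ := hP (B.1 \ A.1) (B.2.diff A.2)
      (by rw [hdiff]; exact tsub_pos_of_lt hlt)
    have hPE : P (A.1 ∪ D) = P A.1 + P D :=
      measure_union (disjoint_sdiff_right.mono_right hDsub) hD
    have hAE : P A.1 < P (A.1 ∪ D) := by
      rw [hPE]
      exact ENNReal.lt_add_right (measure_ne_top _ _) hD0.ne'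
    have hEB : P (A.1 ∪ D) < P B.1 := by
      rw [hPE, add_comm]
      rw [hdiff] at hD1
      exact lt_tsub_iff_right.1 hD1
    let E : {s : Set Ω // MeasurableSet s} := ⟨A.1 ∪ D, A.2.union hD⟩
    have hE : E ∈ C := by
      refine mem_of_isMaxChain hC fun b hb => ?_
      rcases le_total (P b.1) (ENNReal.ofReal t) with h | h
      · exact .inr ⟨(subset_of_isChain hC.1 hb hA (hAmax b hb h)).trans subset_union_left,
          (hAmax b hb h).trans_lt hAE⟩
      · exact .inl ⟨(union_subset hAB (hDsub.trans sdiff_subset)).trans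
          (subset_of_isChain hC.1 hB hb (hBmin b hb h)), hEB.trans_le (hBmin b hb h)⟩
    rcases le_total (P E.1) (ENNReal.ofReal t) with h | h
    · exact absurd (hAmax E hE h) (not_le.2 hAE)
    · exact absurd (hBmin E hE h) (not_le.2 hEB)
  choose A hA hPA using key
  refine ⟨fun t => (A t).1, fun s t hst => subset_of_isChain hC.1 (hA s) (hA t) ?_,
    fun t => (A t).2, hPA⟩
  rw [hPA, hPA]
  exact ENNReal.ofReal_le_ofReal hst

/-- `U ω` is the infimum of the `t` with `ω ∈ A t`, taken over rationals for measurability. The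
event `U < x` lies in `A x` and contains `A q` for rational `q < x`, so it has probability `x`. -/
theorem Atomless.exists_map_eq_volume [IsProbabilityMeasure P] (hP : Atomless P) :
    ∃ U : Ω → unitInterval, Measurable U ∧ P.map U = volume := by
  obtain ⟨A, hmono, hmeas, hPA⟩ := hP.exists_monotone_family
  classical
  -- Rationals are clipped to the unit interval; the default `1` leaves the infimum unaffected and
  -- keeps it there.
  let f : ℚ → Ω → ℝ := fun q ω =>
    if ω ∈ A (projIcc 0 1 zero_le_one (q : ℝ)) then (projIcc 0 1 zero_le_one (q : ℝ) : ℝ) else 1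
  have hfmem : ∀ q ω, f q ω ∈ unitInterval := by
    intro q ω
    simp only [f]
    split_ifs
    · exact Subtype.prop _
    · simp
  have hbdd : ∀ ω, BddBelow (range fun q => f q ω) := fun ω =>
    ⟨0, by rintro _ ⟨q, rfl⟩; exact (hfmem q ω).1⟩
  have hVmem : ∀ ω, (⨅ q, f q ω) ∈ unitInterval := fun ω =>
    ⟨le_ciInf fun q => (hfmem q ω).1, (ciInf_le (hbdd ω) 0).trans (hfmem 0 ω).2⟩
  have hVmeas : Measurable fun ω => ⨅ q, f q ω := by
    refine Measurable.iInf fun q => ?_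
    exact Measurable.ite (hmeas _) measurable_const measurable_const
  refine ⟨fun ω => ⟨⨅ q, f q ω, hVmem ω⟩, hVmeas.subtype_mk, ?_⟩
  have hU : Measurable fun ω => (⟨⨅ q, f q ω, hVmem ω⟩ : unitInterval) := hVmeas.subtype_mk
  have : IsProbabilityMeasure (P.map fun ω => (⟨⨅ q, f q ω, hVmem ω⟩ : unitInterval)) :=
    Measure.isProbabilityMeasure_map hU.aemeasurable
  refine Measure.ext_of_Ici _ _ fun x => ?_
  have hIio : P.map (fun ω => (⟨⨅ q, f q ω, hVmem ω⟩ : unitInterval)) (Iio x) =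
      ENNReal.ofReal x := by
    rw [Measure.map_apply hU measurableSet_Iio]
    have hlt : ∀ ω, (⟨⨅ q, f q ω, hVmem ω⟩ : unitInterval) < x ↔ ∃ q, f q ω < x := fun ω => by
      rw [← Subtype.coe_lt_coe]
      exact ciInf_lt_iff (hbdd ω)
    apply le_antisymm
    · rw [← hPA x]
      refine measure_mono fun ω hω => ?_
      obtain ⟨q, hq⟩ := (hlt ω).1 hω
      simp only [f] at hq
      split_ifs at hq with hmem
      · exact hmono (Subtype.coe_le_coe.1 hq.le) hmem
      · exact absurd hq (not_lt.2 x.2.2)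
    · by_contra! hcon
      rw [← ENNReal.ofReal_toReal (measure_ne_top P _),
        ENNReal.ofReal_lt_ofReal_iff_of_nonneg ENNReal.toReal_nonneg] at hcon
      obtain ⟨q, hq1, hq2⟩ := exists_rat_btwn hcon
      have hq : (q : ℝ) ∈ Icc (0 : ℝ) 1 :=
        ⟨ENNReal.toReal_nonneg.trans hq1.le, hq2.le.trans x.2.2⟩
      refine absurd hq1 (not_lt.2 ?_)
      rw [← ENNReal.ofReal_le_iff_le_toReal (measure_ne_top P _)]
      have hPq := hPA (projIcc 0 1 zero_le_one (q : ℝ))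
      rw [projIcc_of_mem zero_le_one hq] at hPq
      rw [← hPq]
      refine measure_mono fun ω hω => (hlt ω).2 ⟨q, ?_⟩
      simp only [f, projIcc_of_mem zero_le_one hq, if_pos hω]
      exact hq2
  have h2 : (volume : Measure unitInterval) (Iio x) = ENNReal.ofReal x := by
    simp
  rw [← compl_Iio, prob_compl_eq_one_sub measurableSet_Iio,
    prob_compl_eq_one_sub measurableSet_Iio, hIio, h2]

theorem Atomless.exists_map_eq [IsProbabilityMeasure P] (hP : Atomless P) {Y : Type*}
    [MeasurableSpace Y] [StandardBorelSpace Y] [Nonempty Y] (μ : Measure Y)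
    [IsProbabilityMeasure μ] : ∃ X : Ω → Y, Measurable X ∧ P.map X = μ := by
  obtain ⟨U, hU, hPU⟩ := hP.exists_map_eq_volume
  obtain ⟨f, hf, hfμ⟩ := μ.exists_measurable_map_eq
  exact ⟨f ∘ U, hf.comp hU, by rw [← Measure.map_map hf hU, hPU, hfμ]⟩

/-! ### Comonotonic and counter-monotonic pairs -/

/-- Preimages of lower sets under increasing functions are lower sets of the line, and any two of
these are nested. -/
theorem Comonotonic.ae_imp_or {X Y : Ω → ℝ} (h : Comonotonic P X Y) {L M : Set ℝ}
    (hL : IsLowerSet L) (hM : IsLowerSet M) :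
    (∀ᵐ ω ∂P, X ω ∈ L → Y ω ∈ M) ∨ (∀ᵐ ω ∂P, Y ω ∈ M → X ω ∈ L) := by
  obtain ⟨f, g, Z, hf, hg, -, hX, hY⟩ := h
  rcases (hL.preimage hf).total (hM.preimage hg) with h | h
  · left
    filter_upwards [hX, hY] with ω h1 h2
    rw [h1, h2]
    exact fun h3 => h h3
  · right
    filter_upwards [hX, hY] with ω h1 h2
    rw [h1, h2]
    exact fun h3 => h h3

/-- Comonotonic random variables with the same distribution are almost surely equal. -/
theorem Comonotonic.ae_eq [IsFiniteMeasure P] {X Y : Ω → ℝ} (h : Comonotonic P X Y)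
    (hX : Measurable X) (hY : Measurable Y) (hXY : P.map X = P.map Y) : X =ᵐ[P] Y := by
  have key : ∀ q : ℚ, ∀ᵐ ω ∂P, X ω ≤ q ↔ Y ω ≤ q := by
    intro q
    have hm : P (X ⁻¹' Iic (q : ℝ)) = P (Y ⁻¹' Iic (q : ℝ)) := by
      rw [← Measure.map_apply hX measurableSet_Iic, hXY, Measure.map_apply hY measurableSet_Iic]
    have heq : X ⁻¹' Iic (q : ℝ) =ᵐ[P] Y ⁻¹' Iic (q : ℝ) := by
      -- Nested events of equal finite measure agree almost surely.
      rcases h.ae_imp_or (isLowerSet_Iic (q : ℝ)) (isLowerSet_Iic (q : ℝ)) with h1 | h1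
      · exact ae_eq_of_ae_subset_of_measure_ge h1 hm.ge
          (hX measurableSet_Iic).nullMeasurableSet (measure_ne_top _ _)
      · exact (ae_eq_of_ae_subset_of_measure_ge h1 hm.le
          (hY measurableSet_Iic).nullMeasurableSet (measure_ne_top _ _)).symm
    exact heq.mono fun ω hω => Iff.of_eq hω
  filter_upwards [ae_all_iff.2 key] with ω hω
  apply le_antisymm
  · refine le_of_forall_lt_rat_imp_le fun q hq => ?_
    exact (hω q).2 hq.le
  · refine le_of_forall_lt_rat_imp_le fun q hq => ?_
    exact (hω q).1 hq.le

theorem CounterMonotonicPair.ae_disjoint_or_cover {X Y : Ω → ℝ} (h : CounterMonotonicPair P X Y)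
    (s t : ℝ) :
    (∀ᵐ ω ∂P, ¬ (s < X ω ∧ t < Y ω)) ∨ (∀ᵐ ω ∂P, s < X ω ∨ t < Y ω) := by
  rcases h.ae_imp_or (isLowerSet_Iic s) (isLowerSet_Iio (-t)) with h1 | h1
  · right
    filter_upwards [h1] with ω hω
    simp only [mem_Iic, mem_Iio, neg_lt_neg_iff] at hω
    rcases le_or_gt (X ω) s with h2 | h2
    · exact .inr (hω h2)
    · exact .inl h2
  · left
    filter_upwards [h1] with ω hω
    simp only [mem_Iic, mem_Iio, neg_lt_neg_iff] at hω
    exact fun h2 => not_le.2 h2.1 (hω h2.2)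

theorem CounterMonotonicPair.neg {X Y : Ω → ℝ} (h : CounterMonotonicPair P X Y) :
    CounterMonotonicPair P (fun ω => -X ω) (fun ω => -Y ω) := by
  obtain ⟨f, g, Z, hf, hg, hZ, hX, hY⟩ := h
  refine ⟨fun z => -f (-z), fun z => -g (-z), fun ω => -Z ω,
    fun x y hxy => neg_le_neg (hf (neg_le_neg hxy)),
    fun x y hxy => neg_le_neg (hg (neg_le_neg hxy)), hZ.neg, ?_, ?_⟩
  · filter_upwards [hX] with ω hω
    rw [hω, neg_neg]
  · filter_upwards [hY] with ω hω
    rw [hω, neg_neg]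

theorem CounterMonotonicPair.swap {X Y : Ω → ℝ} (h : CounterMonotonicPair P X Y) :
    CounterMonotonicPair P Y X := by
  obtain ⟨f, g, Z, hf, hg, hZ, hX, hY⟩ := h
  refine ⟨fun z => -g (-z), fun z => -f (-z), fun ω => -Z ω,
    fun x y hxy => neg_le_neg (hg (neg_le_neg hxy)),
    fun x y hxy => neg_le_neg (hf (neg_le_neg hxy)), hZ.neg, ?_, ?_⟩
  · filter_upwards [hY] with ω hω
    rw [neg_neg, ← hω, neg_neg]
  · filter_upwards [hX] with ω hω
    rw [hω, neg_neg]

theorem counterMonotonicPair_of_ae_add_eq {X Y : Ω → ℝ} (hX : Measurable X) {c : ℝ}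
    (h : ∀ᵐ ω ∂P, X ω + Y ω = c) : CounterMonotonicPair P X Y := by
  refine ⟨id, fun z => z - c, X, monotone_id, fun x y hxy => sub_le_sub_right hxy c, hX,
    .of_forall fun _ => rfl, ?_⟩
  filter_upwards [h] with ω hω
  linarith

theorem counterMonotonicPair_of_ae_const_right {X Y : Ω → ℝ} (hX : Measurable X) {c : ℝ}
    (h : ∀ᵐ ω ∂P, Y ω = c) : CounterMonotonicPair P X Y := by
  refine ⟨id, fun _ => -c, X, monotone_id, monotone_const, hX, .of_forall fun _ => rfl, ?_⟩
  filter_upwards [h] with ω hω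
  rw [hω]

/-- Random variables that take at most one value besides `m` and `m'`, by the same shift `a` and
never simultaneously, are counter-monotonic. -/
theorem counterMonotonicPair_of_exclusive {X Y : Ω → ℝ} (hX : Measurable X) (hY : Measurable Y)
    {a m m' : ℝ} (h1 : ∀ᵐ ω ∂P, X ω - m = 0 ∨ X ω - m = a)
    (h2 : ∀ᵐ ω ∂P, Y ω - m' = 0 ∨ Y ω - m' = a)
    (h3 : ∀ᵐ ω ∂P, X ω - m = 0 ∨ Y ω - m' = 0) : CounterMonotonicPair P X Y := by
  -- At most one of the two differences is nonzero, so the positive and negative parts of this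
  -- variable recover both; the sign of `a` decides which is which.
  have hZ : Measurable fun ω => (X ω - m) - (Y ω - m') := by fun_prop
  have hmax : Monotone fun z : ℝ => max z 0 := fun x y hxy => max_le_max_right _ hxy
  have hmin : Monotone fun z : ℝ => min z 0 := fun x y hxy => min_le_min_right _ hxy
  rcases le_total 0 a with ha | ha
  · refine ⟨fun z => m + max z 0, fun z => -m' + min z 0, _, hmax.const_add m, hmin.const_add (-m'),
      hZ, ?_, ?_⟩ <;> filter_upwards [h1, h2, h3] with ω h1 h2 h3
    · rcases h1 with h1 | h1 <;> rcases h2 with h2 | h2 <;> rcases h3 with h3 | h3 <;>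
        simp [h1, h2] <;> grind
    · rcases h1 with h1 | h1 <;> rcases h2 with h2 | h2 <;> rcases h3 with h3 | h3 <;>
        simp [h1, h2] <;> grind
  · refine ⟨fun z => m + min z 0, fun z => -m' + max z 0, _, hmin.const_add m, hmax.const_add (-m'),
      hZ, ?_, ?_⟩ <;> filter_upwards [h1, h2, h3] with ω h1 h2 h3
    · rcases h1 with h1 | h1 <;> rcases h2 with h2 | h2 <;> rcases h3 with h3 | h3 <;>
        simp [h1, h2] <;> grind
    · rcases h1 with h1 | h1 <;> rcases h2 with h2 | h2 <;> rcases h3 with h3 | h3 <;>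
        simp [h1, h2] <;> grind

/-! ### Zero-one variables whose means sum to one -/

theorem ae_eq_const_of_integral_le [IsProbabilityMeasure P] {f : Ω → ℝ} {c : ℝ}
    (hf : Integrable f P) (h : ∀ᵐ ω ∂P, c ≤ f ω) (hint : ∫ ω, f ω ∂P ≤ c) :
    ∀ᵐ ω ∂P, f ω = c := by
  have h0 : 0 ≤ᵐ[P] fun ω => f ω - c := h.mono fun ω hω => sub_nonneg.2 hω
  have hi : Integrable (fun ω => f ω - c) P := hf.sub (integrable_const c)
  have h1 : ∫ ω, (f ω - c) ∂P = 0 := by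
    apply le_antisymm
    · rw [integral_sub hf (integrable_const c)]
      simpa using hint
    · exact integral_nonneg_of_ae h0
  exact ((integral_eq_zero_iff_of_nonneg_ae h0 hi).1 h1).mono fun ω hω => sub_eq_zero.1 hω

theorem ae_eq_const_of_le_integral [IsProbabilityMeasure P] {f : Ω → ℝ} {c : ℝ}
    (hf : Integrable f P) (h : ∀ᵐ ω ∂P, f ω ≤ c) (hint : c ≤ ∫ ω, f ω ∂P) :
    ∀ᵐ ω ∂P, f ω = c := by
  have := ae_eq_const_of_integral_le hf.neg (c := -c) (h.mono fun ω hω => neg_le_neg hω)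
    (by simpa [integral_neg] using hint)
  exact this.mono fun ω hω => neg_injective hω

section Exclusive

variable {ι : Type*} [Fintype ι] {W : ι → Ω → ℝ} {p : ι → ℝ}

theorem sum_eq_zero_or_one_of_exclusive {w : ι → ℝ} (h : ∀ i, w i = 0 ∨ w i = 1)
    (h' : ∀ i j, i ≠ j → w i = 0 ∨ w j = 0) : ∑ i, w i = 0 ∨ ∑ i, w i = 1 := by
  by_cases hex : ∃ i, w i = 1
  · obtain ⟨i, hi⟩ := hex
    right
    rw [Finset.sum_eq_single i (fun j _ hj => (h' j i hj).resolve_right (by simp [hi])) (by simp),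
      hi]
  · push Not at hex
    exact .inl (Finset.sum_eq_zero fun i _ => (h i).resolve_right (hex i))

/-- Exclusivity bounds the sum by its mean, one, so it equals one almost surely. -/
theorem ae_sum_eq_one_of_exclusive [IsProbabilityMeasure P] (hint : ∀ i, Integrable (W i) P)
    (h01 : ∀ i, ∀ᵐ ω ∂P, W i ω = 0 ∨ W i ω = 1) (hp : ∑ i, ∫ ω, W i ω ∂P = 1)
    (hexc : ∀ i j, i ≠ j → ∀ᵐ ω ∂P, W i ω = 0 ∨ W j ω = 0) : ∀ᵐ ω ∂P, ∑ i, W i ω = 1 := by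
  refine ae_eq_const_of_le_integral (integrable_finsetSum _ fun i _ => hint i) ?_ ?_
  · have h2 : ∀ᵐ ω ∂P, ∀ i j, i ≠ j → W i ω = 0 ∨ W j ω = 0 := by
      simp only [ae_all_iff]
      exact fun i j hij => hexc i j hij
    filter_upwards [ae_all_iff.2 h01, h2] with ω h1 h2
    rcases sum_eq_zero_or_one_of_exclusive h1 h2 with h | h <;> rw [h]
    exact zero_le_one
  · rw [integral_finsetSum _ fun i _ => hint i, hp]

/-- The constant must be the mean, one, whereas two simultaneous ones would make the sum at least
two. -/
theorem ae_exclusive_of_sum_eq_const [IsProbabilityMeasure P] (hint : ∀ i, Integrable (W i) P)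
    (h01 : ∀ i, ∀ᵐ ω ∂P, W i ω = 0 ∨ W i ω = 1) (hp : ∑ i, ∫ ω, W i ω ∂P = 1) {c : ℝ}
    (hc : ∀ᵐ ω ∂P, ∑ i, W i ω = c) (i j : ι) (hij : i ≠ j) :
    ∀ᵐ ω ∂P, W i ω = 0 ∨ W j ω = 0 := by
  have hc1 : c = 1 := by
    rw [← hp, ← integral_finsetSum _ fun i _ => hint i, integral_congr_ae hc]
    simp
  classical
  filter_upwards [ae_all_iff.2 h01, hc] with ω h1 h2
  by_contra! hcon
  have hi := (h1 i).resolve_left hcon.1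
  have hj := (h1 j).resolve_left hcon.2
  have : ∑ k ∈ {i, j}, W k ω ≤ ∑ k, W k ω :=
    Finset.sum_le_sum_of_subset_of_nonneg (Finset.subset_univ _) fun k _ _ => by
      rcases h1 k with h | h <;> rw [h]
      exact zero_le_one
  rw [Finset.sum_pair hij, hi, hj, h2, hc1] at this
  norm_num at this

end Exclusive

/-! ### Two-point marginals -/

theorem map_mem_frechetClass_iff {n : ℕ} {F : Fin n → Measure ℝ} {X : Ω → Fin n → ℝ}
    (hX : Measurable X) :
    P.map X ∈ frechetClass P F ↔ ∀ i, P.map (fun ω => X ω i) = F i := by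
  constructor
  · rintro ⟨Y, hY, hYF, hXY⟩ i
    have h1 : P.map (fun ω => X ω i) = (P.map X).map fun x => x i :=
      (Measure.map_map (measurable_pi_apply i) hX).symm
    have h2 : P.map (fun ω => Y ω i) = (P.map Y).map fun x => x i :=
      (Measure.map_map (measurable_pi_apply i) hY).symm
    rw [h1, hXY, ← h2, hYF]
  · exact fun h => ⟨X, hX, h, rfl⟩

/-- The distribution that charges `a + m` with mass `p` and `m` with mass `1 - p`. -/
noncomputable def twoPoint (a m p : ℝ) : Measure ℝ :=
  ENNReal.ofReal p • Measure.dirac (a + m) + ENNReal.ofReal (1 - p) • Measure.dirac m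

theorem ae_twoPoint (a m p : ℝ) : ∀ᵐ x ∂twoPoint a m p, x - m = 0 ∨ x - m = a := by
  rw [twoPoint, ae_add_measure_iff]
  constructor <;> refine Measure.ae_smul_measure ?_ _ <;> rw [ae_dirac_eq] <;> simp

theorem integrable_twoPoint (a m p : ℝ) (f : ℝ → ℝ) : Integrable f (twoPoint a m p) :=
  ((integrable_dirac enorm_lt_top).smul_measure ENNReal.ofReal_ne_top).add_measure
    ((integrable_dirac enorm_lt_top).smul_measure ENNReal.ofReal_ne_top)

theorem integral_twoPoint {a m p : ℝ} (hp : p ∈ Icc (0 : ℝ) 1) (f : ℝ → ℝ) :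
    ∫ x, f x ∂twoPoint a m p = p * f (a + m) + (1 - p) * f m := by
  rw [twoPoint, integral_add_measure
    ((integrable_dirac enorm_lt_top).smul_measure ENNReal.ofReal_ne_top)
    ((integrable_dirac enorm_lt_top).smul_measure ENNReal.ofReal_ne_top)]
  simp [ENNReal.toReal_ofReal hp.1, ENNReal.toReal_ofReal (sub_nonneg.2 hp.2)]

section TwoPointMarginals

variable {n : ℕ} {X : Ω → Fin n → ℝ} {a : ℝ} {m p : Fin n → ℝ}

theorem ae_of_map_eq_twoPoint (hX : Measurable X)
    (hF : ∀ i, P.map (fun ω => X ω i) = twoPoint a (m i) (p i)) (i : Fin n) :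
    ∀ᵐ ω ∂P, X ω i - m i = 0 ∨ X ω i - m i = a := by
  have hXi : Measurable fun ω => X ω i := (measurable_pi_apply i).comp hX
  refine ae_of_ae_map (p := fun x => x - m i = 0 ∨ x - m i = a) hXi.aemeasurable ?_
  rw [hF]
  exact ae_twoPoint _ _ _

theorem integrable_of_map_eq_twoPoint (hX : Measurable X)
    (hF : ∀ i, P.map (fun ω => X ω i) = twoPoint a (m i) (p i)) (i : Fin n) :
    Integrable (fun ω => (X ω i - m i) / a) P := by
  have hXi : Measurable fun ω => X ω i := (measurable_pi_apply i).comp hX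
  have : Integrable (fun x => (x - m i) / a) (P.map fun ω => X ω i) := by
    rw [hF]
    exact integrable_twoPoint _ _ _ _
  exact this.comp_measurable hXi

theorem integral_of_map_eq_twoPoint (hX : Measurable X) (hp : p ∈ stdSimplex ℝ (Fin n))
    (hF : ∀ i, P.map (fun ω => X ω i) = twoPoint a (m i) (p i)) (ha : a ≠ 0) (i : Fin n) :
    ∫ ω, (X ω i - m i) / a ∂P = p i := by
  have hXi : Measurable fun ω => X ω i := (measurable_pi_apply i).comp hX
  have hf : Measurable fun x : ℝ => (x - m i) / a := by fun_prop
  rw [← integral_map (f := fun x => (x - m i) / a) hXi.aemeasurable hf.aestronglyMeasurable, hF,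
    integral_twoPoint (mem_Icc_of_mem_stdSimplex hp i)]
  simp [ha]

/-- Either the pair is exclusive or the normalized variables sum to at least one. In the latter case
their mean `p i + p j ≤ 1` forces the sum to equal one, which is again exclusive. -/
theorem ae_exclusive_of_counterMonotonic [IsProbabilityMeasure P] (hX : Measurable X)
    (hp : p ∈ stdSimplex ℝ (Fin n))
    (hF : ∀ i, P.map (fun ω => X ω i) = twoPoint a (m i) (p i)) (ha : a ≠ 0)
    (hCM : CounterMonotonic P X) (i j : Fin n) (hij : i ≠ j) :
    ∀ᵐ ω ∂P, (X ω i - m i) / a = 0 ∨ (X ω j - m j) / a = 0 := by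
  have hi := ae_of_map_eq_twoPoint hX hF i
  have hj := ae_of_map_eq_twoPoint hX hF j
  have key : (∀ᵐ ω ∂P, (X ω i - m i) / a = 0 ∨ (X ω j - m j) / a = 0) ∨
      ∀ᵐ ω ∂P, 1 ≤ (X ω i - m i) / a + (X ω j - m j) / a := by
    -- The threshold is the smaller atom. For `a < 0`, exceeding it means that the normalized
    -- variable vanishes, so the disjoint and covering cases swap roles.
    rcases lt_or_gt_of_ne ha with ha' | ha'
    · rcases (hCM i j hij).ae_disjoint_or_cover (a + m i) (a + m j) with h | h
      · right
        filter_upwards [hi, hj, h] with ω h1 h2 h3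
        rcases h1 with h1 | h1 <;> rcases h2 with h2 | h2 <;> simp [h1, h2, ha]
        exact absurd ⟨by linarith, by linarith⟩ h3
      · left
        filter_upwards [hi, hj, h] with ω h1 h2 h3
        rcases h1 with h1 | h1 <;> rcases h2 with h2 | h2 <;> simp [h1, h2, ha]
        rcases h3 with h3 | h3 <;> linarith
    · rcases (hCM i j hij).ae_disjoint_or_cover (m i) (m j) with h | h
      · left
        filter_upwards [hi, hj, h] with ω h1 h2 h3
        rcases h1 with h1 | h1 <;> rcases h2 with h2 | h2 <;> simp [h1, h2, ha]
        exact h3 ⟨by linarith, by linarith⟩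
      · right
        filter_upwards [hi, hj, h] with ω h1 h2 h3
        rcases h1 with h1 | h1 <;> rcases h2 with h2 | h2 <;> simp [h1, h2, ha]
        rcases h3 with h3 | h3 <;> linarith
  refine key.elim id fun h => ?_
  have hle : p i + p j ≤ 1 := by
    rw [← hp.2, ← Finset.sum_pair hij]
    exact Finset.sum_le_sum_of_subset_of_nonneg (Finset.subset_univ _) fun k _ _ => hp.1 k
  have h1 := ae_eq_const_of_integral_le ((integrable_of_map_eq_twoPoint hX hF i).add
    (integrable_of_map_eq_twoPoint hX hF j)) h (by
      simp only [Pi.add_apply]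
      rw [integral_add (integrable_of_map_eq_twoPoint hX hF i)
        (integrable_of_map_eq_twoPoint hX hF j), integral_of_map_eq_twoPoint hX hp hF ha,
        integral_of_map_eq_twoPoint hX hp hF ha]
      exact hle)
  filter_upwards [hi, hj, h1] with ω h1 h2 h3
  rcases h1 with h1 | h1 <;> rcases h2 with h2 | h2 <;> simp [h1, h2, ha] at h3 ⊢

theorem counterMonotonic_iff_jointMix_of_twoPoint [IsProbabilityMeasure P] (hX : Measurable X)
    (hp : p ∈ stdSimplex ℝ (Fin n))
    (hF : ∀ i, P.map (fun ω => X ω i) = twoPoint a (m i) (p i)) :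
    CounterMonotonic P X ↔ JointMix P X := by
  have h0a := ae_of_map_eq_twoPoint hX hF
  have hXi : ∀ i, Measurable fun ω => X ω i := fun i => (measurable_pi_apply i).comp hX
  rcases eq_or_ne a 0 with rfl | ha
  · have hconst : ∀ i, ∀ᵐ ω ∂P, X ω i = m i := fun i => (h0a i).mono fun ω hω => by
      rw [or_self] at hω
      linarith
    refine iff_of_true
      (fun i j _ => counterMonotonicPair_of_ae_const_right (hXi i) (hconst j)) ⟨∑ i, m i, ?_⟩
    filter_upwards [ae_all_iff.2 hconst] with ω hω
    exact Finset.sum_congr rfl fun i _ => hω i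
  have h01 : ∀ i, ∀ᵐ ω ∂P, (X ω i - m i) / a = 0 ∨ (X ω i - m i) / a = 1 := fun i =>
    (h0a i).mono fun ω hω => hω.imp (fun h => by simp [h]) fun h => by simp [h, ha]
  have hint := integrable_of_map_eq_twoPoint hX hF
  have hsum : ∑ i, ∫ ω, (X ω i - m i) / a ∂P = 1 := by
    simp_rw [integral_of_map_eq_twoPoint hX hp hF ha]
    exact hp.2
  constructor
  · intro hCM
    have h1 := ae_sum_eq_one_of_exclusive hint h01 hsum
      (ae_exclusive_of_counterMonotonic hX hp hF ha hCM)
    refine ⟨a + ∑ i, m i, h1.mono fun ω hω => ?_⟩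
    rw [← Finset.sum_div, div_eq_one_iff_eq ha, Finset.sum_sub_distrib] at hω
    linarith
  · rintro ⟨c, hc⟩ i j hij
    have hc' : ∀ᵐ ω ∂P, ∑ i, (X ω i - m i) / a = (c - ∑ i, m i) / a := hc.mono fun ω hω => by
      rw [← Finset.sum_div, Finset.sum_sub_distrib, hω]
    have hexc := ae_exclusive_of_sum_eq_const hint h01 hsum hc' i j hij
    exact counterMonotonicPair_of_exclusive (hXi i) (hXi j) (h0a i) (h0a j)
      (hexc.mono fun ω hω => by simpa [ha] using hω)

end TwoPointMarginals

/-- Draw an index with law `p` and add `a` to that coordinate of `m`. -/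
theorem Atomless.exists_map_eq_twoPoint [IsProbabilityMeasure P] (hP : Atomless P) {n : ℕ} (a : ℝ)
    (m : Fin n → ℝ) {p : Fin n → ℝ} (hp : p ∈ stdSimplex ℝ (Fin n)) :
    ∃ X : Ω → Fin n → ℝ, Measurable X ∧ (∀ i, P.map (fun ω => X ω i) = twoPoint a (m i) (p i)) ∧
      JointMix P X := by
  let μ : Measure (Fin n) := ∑ i, ENNReal.ofReal (p i) • Measure.dirac i
  have hsum : ∑ i, ENNReal.ofReal (p i) = 1 := by
    rw [← ENNReal.ofReal_sum_of_nonneg fun i _ => hp.1 i, hp.2, ENNReal.ofReal_one]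
  have hμ : IsProbabilityMeasure μ := ⟨by simpa [μ] using hsum⟩
  have : Nonempty (Fin n) := by
    by_contra h
    rw [not_nonempty_iff] at h
    simp at hsum
  obtain ⟨N, hN, hNμ⟩ := hP.exists_map_eq μ
  let g : Fin n → Fin n → ℝ := fun i k => if k = i then a + m i else m i
  have hg : ∀ i, Measurable (g i) := fun i => measurable_of_finite _
  refine ⟨fun ω i => g i (N ω), measurable_pi_lambda _ fun i => (hg i).comp hN, fun i => ?_,
    a + ∑ i, m i, .of_forall fun ω => ?_⟩
  · have h1 : P.map (fun ω => g i (N ω)) = (P.map N).map (g i) :=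
      (Measure.map_map (hg i) hN).symm
    have h2 : ∑ k ∈ Finset.univ.erase i, ENNReal.ofReal (p k) = ENNReal.ofReal (1 - p i) := by
      rw [← ENNReal.ofReal_sum_of_nonneg fun i _ => hp.1 i, ← hp.2,
        ← Finset.sum_erase_add _ p (Finset.mem_univ i), add_sub_cancel_right]
    rw [h1, hNμ]
    simp only [μ]
    rw [← Measure.mapₗ_apply_of_measurable (hg i), map_sum,
      ← Finset.add_sum_erase _ _ (Finset.mem_univ i), twoPoint, ← h2, Finset.sum_smul]
    congr 1
    · simp [Measure.mapₗ_apply_of_measurable (hg i), Measure.map_dirac, g]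
    · refine Finset.sum_congr rfl fun k hk => ?_
      simp [Measure.mapₗ_apply_of_measurable (hg i), Measure.map_dirac, g,
        Finset.ne_of_mem_erase hk]
  · have : ∀ i, g i (N ω) = (if N ω = i then a else 0) + m i := fun i => by
      simp only [g]
      split_ifs <;> simp
    simp only [this, Finset.sum_add_distrib, Finset.sum_ite_eq, Finset.mem_univ, if_true]

/-! ### At most two non-degenerate marginals -/

theorem ae_eq_of_map_eq_dirac {X : Ω → ℝ} (hX : Measurable X) {x : ℝ}
    (h : P.map X = Measure.dirac x) : ∀ᵐ ω ∂P, X ω = x := by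
  refine ae_of_ae_map (p := fun y => y = x) hX.aemeasurable ?_
  rw [h, ae_dirac_eq]
  rfl

theorem map_eq_dirac_of_ae_eq [IsProbabilityMeasure P] {X : Ω → ℝ} {x : ℝ}
    (h : ∀ᵐ ω ∂P, X ω = x) : P.map X = Measure.dirac x := by
  rw [Measure.map_congr (g := fun _ => x) h]
  simp

section TwoNondegenerate

variable {n : ℕ} {F : Fin n → Measure ℝ} {X : Ω → Fin n → ℝ} {i j : Fin n}

theorem ae_sum_eq_of_ae_const (hij : i ≠ j) {x : Fin n → ℝ}
    (hx : ∀ k, k ≠ i → k ≠ j → ∀ᵐ ω ∂P, X ω k = x k) :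
    ∀ᵐ ω ∂P, ∑ k, X ω k = X ω i + X ω j + ∑ k ∈ ({i, j} : Finset (Fin n))ᶜ, x k := by
  have h : ∀ᵐ ω ∂P, ∀ k, k ≠ i → k ≠ j → X ω k = x k := by
    simpa only [ae_all_iff] using hx
  filter_upwards [h] with ω hω
  rw [← Finset.sum_add_sum_compl {i, j}, Finset.sum_pair hij]
  congr 1
  refine Finset.sum_congr rfl fun k hk => ?_
  simp only [Finset.mem_compl, Finset.mem_insert, Finset.mem_singleton, not_or] at hk
  exact hω k hk.1 hk.2

theorem exists_ae_add_eq_of_jointMix (hX : Measurable X)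
    (hF : ∀ k, P.map (fun ω => X ω k) = F k) (hij : i ≠ j)
    (hdeg : ∀ k, k ≠ i → k ≠ j → Degenerate (F k)) (hJM : JointMix P X) :
    ∃ c, ∀ᵐ ω ∂P, X ω i + X ω j = c := by
  have hXi : ∀ k, Measurable fun ω => X ω k := fun k => (measurable_pi_apply k).comp hX
  have : ∀ k, ∃ x, k ≠ i → k ≠ j → ∀ᵐ ω ∂P, X ω k = x := fun k => by
    by_cases hk : k ≠ i ∧ k ≠ j
    · obtain ⟨x, hx⟩ := hdeg k hk.1 hk.2
      exact ⟨x, fun _ _ => ae_eq_of_map_eq_dirac (hXi k) ((hF k).trans hx)⟩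
    · exact ⟨0, fun h1 h2 => absurd ⟨h1, h2⟩ hk⟩
  choose x hx using this
  obtain ⟨c, hc⟩ := hJM
  refine ⟨c - ∑ k ∈ ({i, j} : Finset (Fin n))ᶜ, x k, ?_⟩
  filter_upwards [hc, ae_sum_eq_of_ae_const hij hx] with ω h1 h2
  linarith

theorem symmetricPair_of_jointMix (hX : Measurable X)
    (hF : ∀ k, P.map (fun ω => X ω k) = F k) (hij : i ≠ j)
    (hdeg : ∀ k, k ≠ i → k ≠ j → Degenerate (F k)) (hJM : JointMix P X) :
    SymmetricPair (F i) (F j) := by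
  have hXi : Measurable fun ω => X ω i := (measurable_pi_apply i).comp hX
  obtain ⟨c, hc⟩ := exists_ae_add_eq_of_jointMix hX hF hij hdeg hJM
  refine ⟨c, ?_⟩
  rw [← hF i, ← hF j, Measure.map_map (by fun_prop) hXi]
  refine Measure.map_congr (hc.mono fun ω hω => ?_)
  simp only [Function.comp_apply]
  linarith

theorem jointMix_of_ae_add_eq (hX : Measurable X)
    (hF : ∀ k, P.map (fun ω => X ω k) = F k) (hij : i ≠ j)
    (hdeg : ∀ k, k ≠ i → k ≠ j → Degenerate (F k)) {c : ℝ}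
    (hc : ∀ᵐ ω ∂P, X ω i + X ω j = c) : JointMix P X := by
  have hXi : ∀ k, Measurable fun ω => X ω k := fun k => (measurable_pi_apply k).comp hX
  have : ∀ k, ∃ x, k ≠ i → k ≠ j → ∀ᵐ ω ∂P, X ω k = x := fun k => by
    by_cases hk : k ≠ i ∧ k ≠ j
    · obtain ⟨x, hx⟩ := hdeg k hk.1 hk.2
      exact ⟨x, fun _ _ => ae_eq_of_map_eq_dirac (hXi k) ((hF k).trans hx)⟩
    · exact ⟨0, fun h1 h2 => absurd ⟨h1, h2⟩ hk⟩
  choose x hx using this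
  refine ⟨c + ∑ k ∈ ({i, j} : Finset (Fin n))ᶜ, x k, ?_⟩
  filter_upwards [hc, ae_sum_eq_of_ae_const hij hx] with ω h1 h2
  rw [h2, h1]

theorem counterMonotonic_of_ae_add_eq (hX : Measurable X)
    (hF : ∀ k, P.map (fun ω => X ω k) = F k)
    (hdeg : ∀ k, k ≠ i → k ≠ j → Degenerate (F k)) {c : ℝ}
    (hc : ∀ᵐ ω ∂P, X ω i + X ω j = c) : CounterMonotonic P X := by
  have hXi : ∀ k, Measurable fun ω => X ω k := fun k => (measurable_pi_apply k).comp hX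
  have hij := counterMonotonicPair_of_ae_add_eq (hXi i) hc
  intro k l hkl
  by_cases hl : l ≠ i ∧ l ≠ j
  · obtain ⟨x, hx⟩ := hdeg l hl.1 hl.2
    exact counterMonotonicPair_of_ae_const_right (hXi k)
      (ae_eq_of_map_eq_dirac (hXi l) ((hF l).trans hx))
  by_cases hk : k ≠ i ∧ k ≠ j
  · obtain ⟨x, hx⟩ := hdeg k hk.1 hk.2
    exact (counterMonotonicPair_of_ae_const_right (hXi l)
      (ae_eq_of_map_eq_dirac (hXi k) ((hF k).trans hx))).swap
  have hl' : l = i ∨ l = j := by tauto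
  have hk' : k = i ∨ k = j := by tauto
  rcases hl' with rfl | rfl <;> rcases hk' with rfl | rfl
  · exact absurd rfl hkl
  · exact hij.swap
  · exact hij
  · exact absurd rfl hkl

/-- `c - Y` is comonotonic with `X` and has the same law, so the two coincide. -/
theorem ae_add_eq_of_counterMonotonicPair [IsFiniteMeasure P] {X Y : Ω → ℝ}
    (hX : Measurable X) (hY : Measurable Y) {c : ℝ} (hXY : (P.map X).map (fun x => c - x) = P.map Y)
    (h : CounterMonotonicPair P X Y) : ∀ᵐ ω ∂P, X ω + Y ω = c := by
  obtain ⟨f, g, Z, hf, hg, hZ, h1, h2⟩ := h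
  have hco : Comonotonic P X fun ω => c - Y ω :=
    ⟨f, fun z => c + g z, Z, hf, hg.const_add c, hZ, h1, h2.mono fun ω hω => by
      dsimp only at hω ⊢
      linarith⟩
  have hlaw : P.map X = P.map fun ω => c - Y ω := by
    have h3 : (P.map fun ω => c - Y ω) = (P.map Y).map fun y => c - y :=
      (Measure.map_map (by fun_prop) hY).symm
    rw [h3, ← hXY, Measure.map_map (by fun_prop) (by fun_prop)]
    simp
  filter_upwards [hco.ae_eq hX (hY.const_sub c) hlaw] with ω hω
  linarith

theorem counterMonotonic_iff_jointMix_of_symmetricDegenerate [IsFiniteMeasure P]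
    (hX : Measurable X) (hF : ∀ k, P.map (fun ω => X ω k) = F k)
    (h : SymmetricDegenerateCondition F) : CounterMonotonic P X ↔ JointMix P X := by
  obtain ⟨i, j, hij, ⟨c, hc⟩, hdeg⟩ := h
  have hXi : ∀ k, Measurable fun ω => X ω k := fun k => (measurable_pi_apply k).comp hX
  constructor
  · intro hCM
    exact jointMix_of_ae_add_eq hX hF hij hdeg
      (ae_add_eq_of_counterMonotonicPair (hXi i) (hXi j) (by rw [hF, hF, hc]) (hCM i j hij))
  · intro hJM
    obtain ⟨c', hc'⟩ := exists_ae_add_eq_of_jointMix hX hF hij hdeg hJM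
    exact counterMonotonic_of_ae_add_eq hX hF hdeg hc'

theorem SymmetricDegenerateCondition.exists_jointMix [IsProbabilityMeasure P] (hP : Atomless P)
    [∀ i, IsProbabilityMeasure (F i)] (h : SymmetricDegenerateCondition F) :
    ∃ X : Ω → Fin n → ℝ, Measurable X ∧ (∀ i, P.map (fun ω => X ω i) = F i) ∧ JointMix P X := by
  obtain ⟨i, j, hij, ⟨c, hc⟩, hdeg⟩ := h
  obtain ⟨Y, hY, hYF⟩ := hP.exists_map_eq (F i)
  have : ∀ k, ∃ x, k ≠ i → k ≠ j → F k = Measure.dirac x := fun k => by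
    by_cases hk : k ≠ i ∧ k ≠ j
    · exact (hdeg k hk.1 hk.2).imp fun x hx _ _ => hx
    · exact ⟨0, fun h1 h2 => absurd ⟨h1, h2⟩ hk⟩
  choose x hx using this
  let X : Ω → Fin n → ℝ := fun ω k => if k = i then Y ω else if k = j then c - Y ω else x k
  have hX : Measurable X := by
    refine measurable_pi_lambda _ fun k => ?_
    by_cases hki : k = i
    · simpa [X, hki] using hY
    by_cases hkj : k = j
    · simpa [X, hki, hkj, hij.symm] using hY.const_sub c
    · simp [X, hki, hkj]
  have hXF : ∀ k, P.map (fun ω => X ω k) = F k := by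
    intro k
    by_cases hki : k = i
    · simpa [X, hki] using hYF
    by_cases hkj : k = j
    · subst hkj
      rw [← hc, ← hYF, Measure.map_map (by fun_prop) hY]
      simp [X, hij.symm, Function.comp_def]
    · simp [X, hki, hkj, hx k hki hkj]
  refine ⟨X, hX, hXF, jointMix_of_ae_add_eq hX hXF hij hdeg (c := c) (.of_forall fun ω => ?_)⟩
  simp [X, hij.symm]

end TwoNondegenerate

/-! ### Cuts, essential infima and propagation of disjointness -/

/-- `s` is a cut of `X` if both `X ≤ s` and `s < X` have positive probability. -/
def IsCut (P : Measure Ω) (X : Ω → ℝ) (s : ℝ) : Prop :=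
  (¬ ∀ᵐ ω ∂P, s < X ω) ∧ ¬ ∀ᵐ ω ∂P, X ω ≤ s

/-- `s` is a strict cut of `X` if both `X < s` and `s < X` have positive probability. -/
def IsStrictCut (P : Measure Ω) (X : Ω → ℝ) (s : ℝ) : Prop :=
  (¬ ∀ᵐ ω ∂P, s ≤ X ω) ∧ ¬ ∀ᵐ ω ∂P, X ω ≤ s

theorem IsStrictCut.isCut {X : Ω → ℝ} {s : ℝ} (h : IsStrictCut P X s) : IsCut P X s :=
  ⟨fun h1 => h.1 (h1.mono fun _ => le_of_lt), h.2⟩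

theorem IsStrictCut.neg {X : Ω → ℝ} {s : ℝ} (h : IsStrictCut P X s) :
    IsStrictCut P (fun ω => -X ω) (-s) :=
  ⟨fun h1 => h.2 (h1.mono fun _ => neg_le_neg_iff.1),
    fun h1 => h.1 (h1.mono fun _ => neg_le_neg_iff.1)⟩

section EssentialInfimum

variable [NeZero P] {X : Ω → ℝ}

theorem exists_not_ae_lt (X : Ω → ℝ) : ∃ s : ℝ, ¬ ∀ᵐ ω ∂P, s < X ω := by
  by_contra! h
  have h1 : ∀ᵐ ω ∂P, ∀ n : ℕ, (n : ℝ) < X ω := ae_all_iff.2 fun n => h n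
  obtain ⟨ω, hω⟩ := h1.exists
  obtain ⟨n, hn⟩ := exists_nat_gt (X ω)
  exact absurd (hω n) (not_lt.2 hn.le)

theorem exists_essential_infimum (h : ∃ s : ℝ, ∀ᵐ ω ∂P, s < X ω) :
    ∃ m : ℝ, (∀ᵐ ω ∂P, m ≤ X ω) ∧ ∀ s, m < s → ¬ ∀ᵐ ω ∂P, s < X ω := by
  set S : Set ℝ := {s | ∀ᵐ ω ∂P, s < X ω} with hS
  have hbdd : BddAbove S := by
    obtain ⟨b, hb⟩ := exists_not_ae_lt (P := P) X
    refine ⟨b, fun s hs => ?_⟩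
    by_contra! hbs
    exact hb (Eventually.mono hs fun ω hω => hbs.trans hω)
  obtain ⟨u, -, hu, hmem⟩ := exists_seq_tendsto_sSup h hbdd
  refine ⟨sSup S, ?_, fun s hs hs' => absurd (le_csSup hbdd hs') (not_le.2 hs)⟩
  filter_upwards [ae_all_iff.2 hmem] with ω hω
  exact le_of_tendsto' hu fun n => (hω n).le

/-- A random variable without strict cut is almost surely constant. -/
theorem exists_ae_eq_const_of_not_isStrictCut (h : ∀ s, ¬ IsStrictCut P X s) :
    ∃ x, ∀ᵐ ω ∂P, X ω = x := by
  have h' : ∀ s, (∀ᵐ ω ∂P, s ≤ X ω) ∨ ∀ᵐ ω ∂P, X ω ≤ s := fun s => by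
    by_contra hcon
    exact h s (not_or.1 hcon)
  have hlow : ∃ s : ℝ, ∀ᵐ ω ∂P, s < X ω := by
    by_contra! hcon
    have h1 : ∀ s, ∀ᵐ ω ∂P, X ω ≤ s := fun s =>
      (h' s).resolve_left fun h2 => hcon (s - 1) (h2.mono fun ω hω => by linarith)
    have h2 : ∀ᵐ ω ∂P, ∀ n : ℕ, X ω ≤ -(n : ℝ) := ae_all_iff.2 fun n => h1 _
    obtain ⟨ω, hω⟩ := h2.exists
    obtain ⟨n, hn⟩ := exists_nat_gt (-X ω)
    have := hω n
    linarith
  obtain ⟨m, hm, hm'⟩ := exists_essential_infimum hlow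
  have h1 : ∀ᵐ ω ∂P, ∀ q : ℚ, m < q → X ω ≤ q := by
    rw [ae_all_iff]
    intro q
    rw [ae_all_iff]
    intro hq
    refine (h' q).resolve_left fun h2 => ?_
    obtain ⟨s, hs1, hs2⟩ := exists_between hq
    exact hm' s hs1 (h2.mono fun ω hω => hs2.trans_le hω)
  refine ⟨m, ?_⟩
  filter_upwards [hm, h1] with ω h2 h3
  refine le_antisymm (le_of_forall_lt_rat_imp_le fun q hq => h3 q hq) h2

end EssentialInfimum

/-- If `A` and `C` covered, disjointness of `B` and `C` would make `B` null, and covering by `B` and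
`C` would make `C` almost sure. -/
theorem not_ae_of_disjoint_of_cover {A B C : Ω → Prop} (hB : ¬ ∀ᵐ ω ∂P, ¬ B ω)
    (hC : ¬ ∀ᵐ ω ∂P, C ω) (hAB : ∀ᵐ ω ∂P, ¬ (A ω ∧ B ω))
    (hBC : (∀ᵐ ω ∂P, ¬ (B ω ∧ C ω)) ∨ ∀ᵐ ω ∂P, B ω ∨ C ω) : ¬ ∀ᵐ ω ∂P, A ω ∨ C ω := by
  intro hAC
  rcases hBC with hBC | hBC
  · refine hB ?_
    filter_upwards [hAB, hAC, hBC] with ω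
    tauto
  · refine hC ?_
    filter_upwards [hAB, hAC, hBC] with ω
    tauto

section Cuts

variable {n : ℕ} {X : Ω → Fin n → ℝ}

theorem CounterMonotonic.ae_disjoint_of_triple (hCM : CounterMonotonic P X) {i j k : Fin n}
    (hik : i ≠ k) (hjk : j ≠ k) {s t u : ℝ} (ht : IsCut P (fun ω => X ω j) t)
    (hu : IsCut P (fun ω => X ω k) u) (h : ∀ᵐ ω ∂P, ¬ (s < X ω i ∧ t < X ω j)) :
    ∀ᵐ ω ∂P, ¬ (s < X ω i ∧ u < X ω k) :=
  ((hCM i k hik).ae_disjoint_or_cover s u).resolve_right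
    (not_ae_of_disjoint_of_cover (A := fun ω => s < X ω i) (B := fun ω => t < X ω j)
      (C := fun ω => u < X ω k) (by simpa using ht.2) hu.1 h
      ((hCM j k hjk).ae_disjoint_or_cover t u))

theorem CounterMonotonic.ae_disjoint_right (hCM : CounterMonotonic P X)
    (h3 : ∀ a b : Fin n, ∃ k, k ≠ a ∧ k ≠ b ∧ ∃ u, IsCut P (fun ω => X ω k) u) {i j k : Fin n}
    (hij : i ≠ j) (hik : i ≠ k) {s t u : ℝ} (ht : IsCut P (fun ω => X ω j) t)
    (hu : IsCut P (fun ω => X ω k) u) (h : ∀ᵐ ω ∂P, ¬ (s < X ω i ∧ t < X ω j)) :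
    ∀ᵐ ω ∂P, ¬ (s < X ω i ∧ u < X ω k) := by
  by_cases hjk : j = k
  · subst hjk
    -- To change the threshold of the same component, go through a third one and return.
    obtain ⟨l, hli, hlj, v, hv⟩ := h3 i j
    exact hCM.ae_disjoint_of_triple hij hlj hv hu
      (hCM.ae_disjoint_of_triple hli.symm hlj.symm ht hv h)
  · exact hCM.ae_disjoint_of_triple hik hjk ht hu h

theorem CounterMonotonic.ae_disjoint (hCM : CounterMonotonic P X)
    (h3 : ∀ a b : Fin n, ∃ k, k ≠ a ∧ k ≠ b ∧ ∃ u, IsCut P (fun ω => X ω k) u) {i j : Fin n}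
    (hij : i ≠ j) {s t : ℝ} (hs : IsCut P (fun ω => X ω i) s) (ht : IsCut P (fun ω => X ω j) t)
    (h : ∀ᵐ ω ∂P, ¬ (s < X ω i ∧ t < X ω j)) {i' j' : Fin n} (hij' : i' ≠ j') {s' t' : ℝ}
    (hs' : IsCut P (fun ω => X ω i') s') (ht' : IsCut P (fun ω => X ω j') t') :
    ∀ᵐ ω ∂P, ¬ (s' < X ω i' ∧ t' < X ω j') := by
  by_cases hii : i = i'
  · subst hii
    have h1 := hCM.ae_disjoint_right h3 hij hij' ht ht' h
    have h2 := hCM.ae_disjoint_right h3 hij'.symm hij'.symm hs hs' (h1.mono fun ω hω => by tauto)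
    exact h2.mono fun ω hω => by tauto
  · have h1 := hCM.ae_disjoint_right h3 hij hii ht hs' h
    exact hCM.ae_disjoint_right h3 (Ne.symm hii) hij' hs ht' (h1.mono fun ω hω => by tauto)

/-- For `s` far to the left, `X ≤ s` is less likely than `u < Y`. At a cut, disjointness would put
the latter event inside the former, so `s` is no cut. -/
theorem exists_ae_lt_of_ae_disjoint [IsProbabilityMeasure P] {X Y : Ω → ℝ} (hX : Measurable X)
    {u : ℝ} (hu : IsCut P Y u)
    (h : ∀ s, IsCut P X s → ∀ᵐ ω ∂P, ¬ (s < X ω ∧ u < Y ω)) : ∃ s, ∀ᵐ ω ∂P, s < X ω := by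
  have hε : 0 < P {ω | u < Y ω} := by
    rw [pos_iff_ne_zero]
    intro h0
    refine hu.2 ?_
    rw [ae_iff]
    simpa using h0
  have : IsProbabilityMeasure (P.map X) := Measure.isProbabilityMeasure_map hX.aemeasurable
  have hlim := ENNReal.tendsto_ofReal (ProbabilityTheory.tendsto_cdf_atBot (P.map X))
  simp only [ProbabilityTheory.ofReal_cdf, ENNReal.ofReal_zero] at hlim
  obtain ⟨s, hs⟩ := (hlim.eventually_lt_const hε).exists
  rw [Measure.map_apply hX measurableSet_Iic] at hs
  refine ⟨s, ?_⟩
  by_contra hcon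
  have hcut : IsCut P X s := by
    refine ⟨hcon, fun h1 => ?_⟩
    have h2 : P (X ⁻¹' Iic s) = 1 := by
      rw [← prob_compl_eq_zero_iff (hX measurableSet_Iic)]
      exact h1
    rw [h2] at hs
    exact absurd prob_le_one (not_le.2 hs)
  refine absurd (measure_mono_ae ((h s hcut).mono fun ω hω (hω' : u < Y ω) => ?_)) (not_le.2 hs)
  exact not_lt.1 fun h2 => hω ⟨h2, hω'⟩

/-- If one pair of upper cut events of a counter-monotonic vector is disjoint and there are enough
cuts, then the components are bounded below and exceed their essential infima on disjoint events. -/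
theorem CounterMonotonic.exists_essential_infima [IsProbabilityMeasure P]
    (hCM : CounterMonotonic P X) (hX : Measurable X)
    (h3 : ∀ a b : Fin n, ∃ k, k ≠ a ∧ k ≠ b ∧ ∃ u, IsCut P (fun ω => X ω k) u) {i j : Fin n}
    (hij : i ≠ j) {s t : ℝ} (hs : IsCut P (fun ω => X ω i) s) (ht : IsCut P (fun ω => X ω j) t)
    (h : ∀ᵐ ω ∂P, ¬ (s < X ω i ∧ t < X ω j)) :
    ∃ m : Fin n → ℝ, (∀ i, ∀ᵐ ω ∂P, m i ≤ X ω i) ∧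
      ∀ i j, i ≠ j → ∀ᵐ ω ∂P, ¬ (m i < X ω i ∧ m j < X ω j) := by
  have hall : ∀ {i' j' : Fin n}, i' ≠ j' → ∀ {s' t' : ℝ}, IsCut P (fun ω => X ω i') s' →
      IsCut P (fun ω => X ω j') t' → ∀ᵐ ω ∂P, ¬ (s' < X ω i' ∧ t' < X ω j') :=
    fun hij' _ _ hs' ht' => hCM.ae_disjoint h3 hij hs ht h hij' hs' ht'
  have hm : ∀ i, ∃ m : ℝ, (∀ᵐ ω ∂P, m ≤ X ω i) ∧ ∀ s, m < s → ¬ ∀ᵐ ω ∂P, s < X ω i := by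
    intro i
    obtain ⟨k, hki, -, u, hu⟩ := h3 i i
    exact exists_essential_infimum (exists_ae_lt_of_ae_disjoint
      ((measurable_pi_apply i).comp hX) hu fun s hs => hall hki.symm hs hu)
  choose m hm hm' using hm
  refine ⟨m, hm, fun i j hij => ?_⟩
  -- Rationals above the essential infima are cuts or almost sure upper bounds; countably many of
  -- them exhaust the strict exceedances.
  have key : ∀ᵐ ω ∂P, ∀ q r : ℚ, m i < q → m j < r → ¬ (q < X ω i ∧ r < X ω j) := by
    simp only [ae_all_iff]
    intro q r hq hr
    by_cases h1 : ∀ᵐ ω ∂P, X ω i ≤ q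
    · exact h1.mono fun ω hω hω' => not_lt.2 hω hω'.1
    by_cases h2 : ∀ᵐ ω ∂P, X ω j ≤ r
    · exact h2.mono fun ω hω hω' => not_lt.2 hω hω'.2
    exact hall hij ⟨hm' i q hq, h1⟩ ⟨hm' j r hr, h2⟩
  filter_upwards [key] with ω hω
  rintro ⟨h1, h2⟩
  obtain ⟨q, hq1, hq2⟩ := exists_rat_btwn h1
  obtain ⟨r, hr1, hr2⟩ := exists_rat_btwn h2
  exact hω q r hq1 hr1 ⟨hq2, hr2⟩

end Cuts

/-! ### Three non-degenerate marginals force the two-point form -/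

theorem map_ite_const {S : Set Ω} (hS : MeasurableSet S) [DecidablePred (· ∈ S)] (x y : ℝ) :
    P.map (fun ω => if ω ∈ S then x else y) =
      P S • Measure.dirac x + P Sᶜ • Measure.dirac y := by
  have hf : Measurable fun ω => if ω ∈ S then x else y :=
    Measurable.ite hS measurable_const measurable_const
  have hadd := Measure.map_add (P.restrict S) (P.restrict Sᶜ) hf
  rw [Measure.restrict_add_restrict_compl hS] at hadd
  rw [hadd]
  congr 1
  · rw [Measure.map_congr (g := fun _ => x), Measure.map_const]
    · simp
    · filter_upwards [ae_restrict_mem hS] with ω hω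
      rw [if_pos hω]
  · rw [Measure.map_congr (g := fun _ => y), Measure.map_const]
    · simp
    · filter_upwards [ae_restrict_mem hS.compl] with ω hω
      rw [if_neg hω]

theorem map_neg_map_neg (F : Measure ℝ) : (F.map fun x => -x).map (fun x => -x) = F := by
  rw [Measure.map_map measurable_neg measurable_neg]
  simp

theorem TwoPointCondition.of_map_neg {n : ℕ} {F : Fin n → Measure ℝ}
    (h : TwoPointCondition fun i => (F i).map fun x => -x) : TwoPointCondition F := by
  obtain ⟨a, m, p, hp, hF⟩ := h
  refine ⟨-a, fun i => -m i, p, hp, fun i => ?_⟩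
  dsimp only at hF
  rw [← map_neg_map_neg (F i), hF, Measure.map_add _ _ measurable_neg, Measure.map_smul, Measure.map_smul,
    Measure.map_dirac, Measure.map_dirac]
  congr 3
  ring

section JointMix

variable [IsProbabilityMeasure P] {n : ℕ} {F : Fin n → Measure ℝ} {Y : Ω → Fin n → ℝ}

/-- Lower bounds that are exceeded with total probability at most one force a joint mix to have
marginal distributions as in the two-point condition. -/
theorem twoPointCondition_of_jointMix (hY : Measurable Y)
    (hF : ∀ i, P.map (fun ω => Y ω i) = F i) (hJM : JointMix P Y) {m : Fin n → ℝ}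
    (hm : ∀ i, ∀ᵐ ω ∂P, m i ≤ Y ω i) (hsum : ∑ i, P {ω | m i < Y ω i} ≤ 1)
    (hdeg : ∃ i, ¬ Degenerate (F i)) : TwoPointCondition F := by
  classical
  obtain ⟨c, hc⟩ := hJM
  obtain ⟨i₀, hi₀⟩ := hdeg
  have hYi : ∀ i, Measurable fun ω => Y ω i := fun i => (measurable_pi_apply i).comp hY
  have hmeas : ∀ i, MeasurableSet {ω | m i < Y ω i} := fun i =>
    measurableSet_lt measurable_const (hYi i)
  set a := c - ∑ i, m i with ha
  have hc' : ∀ᵐ ω ∂P, ∑ i, (Y ω i - m i) = a := hc.mono fun ω hω => by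
    rw [Finset.sum_sub_distrib, hω]
  have ha0 : a ≠ 0 := by
    intro ha0
    refine hi₀ ⟨m i₀, ?_⟩
    rw [← hF]
    apply map_eq_dirac_of_ae_eq
    filter_upwards [hc', ae_all_iff.2 hm] with ω h1 h2
    rw [ha0, Finset.sum_eq_zero_iff_of_nonneg fun i _ => sub_nonneg.2 (h2 i)] at h1
    exact sub_eq_zero.1 (h1 i₀ (Finset.mem_univ _))
  let W : Fin n → Ω → ℝ := fun i => {ω | m i < Y ω i}.indicator 1
  have hWint : ∀ i, Integrable (W i) P := fun i => (integrable_const 1).indicator (hmeas i)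
  have hWP : ∀ i, ∫ ω, W i ω ∂P = P.real {ω | m i < Y ω i} := fun i =>
    integral_indicator_one (hmeas i)
  have hp1 : ∑ i, P.real {ω | m i < Y ω i} ≤ 1 := by
    simp only [Measure.real]
    rw [← ENNReal.toReal_sum fun i _ => measure_ne_top _ _]
    exact ENNReal.toReal_le_of_le_ofReal zero_le_one (by simpa using hsum)
  have hWnn : ∀ i ω, 0 ≤ W i ω := fun i ω => indicator_nonneg (fun _ _ => zero_le_one) ω
  -- The count of exceedances is at least one because the total excess is `a ≠ 0`, and its mean is
  -- at most one.
  have hW1 : ∀ᵐ ω ∂P, ∑ i, W i ω = 1 := by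
    refine ae_eq_const_of_integral_le (integrable_finsetSum _ fun i _ => hWint i) ?_ ?_
    · filter_upwards [hc', ae_all_iff.2 hm] with ω h1 h2
      obtain ⟨i, hi⟩ : ∃ i, m i < Y ω i := by
        by_contra! hcon
        exact ha0 (h1 ▸ Finset.sum_eq_zero fun i _ => sub_eq_zero.2 ((hcon i).antisymm (h2 i)))
      have h3 : W i ω = 1 := indicator_of_mem (s := {ω | m i < Y ω i}) hi _
      rw [← h3]
      exact Finset.single_le_sum (fun j _ => hWnn j ω) (Finset.mem_univ i)
    · rw [integral_finsetSum _ fun i _ => hWint i]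
      simpa only [hWP] using hp1
  refine ⟨a, m, fun i => P.real {ω | m i < Y ω i}, ⟨fun i => measureReal_nonneg, ?_⟩, fun i => ?_⟩
  · simp only [← hWP]
    rw [← integral_finsetSum _ fun i _ => hWint i, integral_congr_ae hW1]
    simp
  · have hval : (fun ω => Y ω i) =ᵐ[P]
        fun ω => if ω ∈ {ω | m i < Y ω i} then a + m i else m i := by
      filter_upwards [hc', ae_all_iff.2 hm, hW1] with ω h1 h2 h3
      by_cases hi : m i < Y ω i
      · have h4 : W i ω = 1 := indicator_of_mem (s := {ω | m i < Y ω i}) hi _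
        rw [← Finset.add_sum_erase _ _ (Finset.mem_univ i), h4, add_eq_left,
          Finset.sum_eq_zero_iff_of_nonneg fun j _ => hWnn j ω] at h3
        have h5 : ∀ j ∈ Finset.univ.erase i, Y ω j - m j = 0 := fun j hj => by
          by_contra hne
          have hj' : m j < Y ω j := (h2 j).lt_of_ne fun h => hne (sub_eq_zero.2 h.symm)
          have h6 : W j ω = 1 := indicator_of_mem (s := {ω | m j < Y ω j}) hj' _
          rw [h3 j hj] at h6
          exact zero_ne_one h6
        rw [← Finset.add_sum_erase _ _ (Finset.mem_univ i), Finset.sum_eq_zero h5, add_zero] at h1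
        rw [if_pos (by exact hi)]
        linarith
      · rw [if_neg (by exact hi)]
        exact (not_lt.1 hi).antisymm (h2 i)
    rw [← hF, Measure.map_congr hval, map_ite_const (hmeas i), ← probReal_compl_eq_one_sub (hmeas i),
      ofReal_measureReal, ofReal_measureReal]

end JointMix

section ThreeNondegenerate

variable [IsProbabilityMeasure P] {n : ℕ} {F : Fin n → Measure ℝ} {X Y : Ω → Fin n → ℝ}

/-- Disjoint exceedances of `X` give the lower bounds and the probability bound, both of which
depend only on the laws shared with `Y`. -/
theorem twoPointCondition_of_ae_disjoint (hX : Measurable X)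
    (hXF : ∀ i, P.map (fun ω => X ω i) = F i) (hCM : CounterMonotonic P X) (hY : Measurable Y)
    (hYF : ∀ i, P.map (fun ω => Y ω i) = F i) (hJM : JointMix P Y)
    (h3 : ∀ a b : Fin n, ∃ k, k ≠ a ∧ k ≠ b ∧ ∃ u, IsCut P (fun ω => X ω k) u) {i j : Fin n}
    (hij : i ≠ j) {s t : ℝ} (hs : IsCut P (fun ω => X ω i) s) (ht : IsCut P (fun ω => X ω j) t)
    (h : ∀ᵐ ω ∂P, ¬ (s < X ω i ∧ t < X ω j)) (hdeg : ∃ i, ¬ Degenerate (F i)) :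
    TwoPointCondition F := by
  obtain ⟨m, hm, hdisj⟩ := hCM.exists_essential_infima hX h3 hij hs ht h
  have hXi : ∀ i, Measurable fun ω => X ω i := fun i => (measurable_pi_apply i).comp hX
  have hYi : ∀ i, Measurable fun ω => Y ω i := fun i => (measurable_pi_apply i).comp hY
  refine twoPointCondition_of_jointMix hY hYF hJM (m := m) (fun i => ?_) ?_ hdeg
  · refine ae_of_ae_map (p := fun y => m i ≤ y) (hYi i).aemeasurable ?_
    rw [hYF, ← hXF]
    exact (ae_map_iff (hXi i).aemeasurable measurableSet_Ici).2 (hm i)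
  · have hlaw : ∀ i, P {ω | m i < Y ω i} = P {ω | m i < X ω i} := fun i => by
      have h1 : P.map (fun ω => Y ω i) (Ioi (m i)) = P.map (fun ω => X ω i) (Ioi (m i)) := by
        rw [hYF, hXF]
      rwa [Measure.map_apply (hYi i) measurableSet_Ioi,
        Measure.map_apply (hXi i) measurableSet_Ioi] at h1
    have hunion : P (⋃ i, {ω | m i < X ω i}) = ∑' i, P {ω | m i < X ω i} := by
      refine measure_iUnion₀ (fun i j hij => ?_) fun i =>
        (measurableSet_lt measurable_const (hXi i)).nullMeasurableSet
      have := hdisj i j hij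
      rw [ae_iff] at this
      simpa [AEDisjoint, Function.onFun, ofPred_and] using this
    simp only [hlaw]
    rw [← tsum_fintype (L := .unconditional _), ← hunion]
    exact prob_le_one

theorem exists_isStrictCut_of_not_degenerate {X : Ω → ℝ} (h : ¬ Degenerate (P.map X)) :
    ∃ s, IsStrictCut P X s := by
  by_contra! hcon
  obtain ⟨x, hx⟩ := exists_ae_eq_const_of_not_isStrictCut hcon
  exact h ⟨x, map_eq_dirac_of_ae_eq hx⟩

theorem twoPointCondition_of_counterMonotonic_of_jointMix (hX : Measurable X)
    (hXF : ∀ i, P.map (fun ω => X ω i) = F i) (hCM : CounterMonotonic P X) (hY : Measurable Y)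
    (hYF : ∀ i, P.map (fun ω => Y ω i) = F i) (hJM : JointMix P Y)
    (h3 : 3 ≤ numNondegenerate F) : TwoPointCondition F := by
  have hnd : ∀ a b : Fin n, ∃ k, k ≠ a ∧ k ≠ b ∧ ¬ Degenerate (F k) := by
    intro a b
    have hlt : ({a, b} : Set (Fin n)).ncard < {i | ¬ Degenerate (F i)}.ncard :=
      ((ncard_insert_le a {b}).trans (by simp)).trans_lt h3
    obtain ⟨k, hk, hkab⟩ := exists_mem_notMem_of_ncard_lt_ncard hlt
    simp only [mem_insert_iff, mem_singleton_iff, not_or] at hkab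
    exact ⟨k, hkab.1, hkab.2, hk⟩
  obtain ⟨i, hi⟩ : {i | ¬ Degenerate (F i)}.Nonempty := by
    apply nonempty_of_ncard_ne_zero
    unfold numNondegenerate at h3
    omega
  obtain ⟨j, hji, -, hj⟩ := hnd i i
  have hcut : ∀ k, ¬ Degenerate (F k) → ∃ s, IsStrictCut P (fun ω => X ω k) s := fun k hk =>
    exists_isStrictCut_of_not_degenerate (by rwa [hXF])
  obtain ⟨s, hs⟩ := hcut i hi
  obtain ⟨t, ht⟩ := hcut j hj
  -- In the covering case `X i < s` and `X j < t` exclude each other, so negation gives disjoint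
  -- upper events. The cuts were chosen strict so that they stay cuts after negation.
  rcases (hCM i j hji.symm).ae_disjoint_or_cover s t with h | h
  · refine twoPointCondition_of_ae_disjoint hX hXF hCM hY hYF hJM (fun a b => ?_) hji.symm hs.isCut
      ht.isCut h ⟨i, hi⟩
    obtain ⟨k, hka, hkb, hk⟩ := hnd a b
    obtain ⟨u, hu⟩ := hcut k hk
    exact ⟨k, hka, hkb, u, hu.isCut⟩
  · have hmap : ∀ {Z : Ω → Fin n → ℝ}, Measurable Z → (∀ k, P.map (fun ω => Z ω k) = F k) →
        ∀ k, P.map (fun ω => (-Z ω) k) = (F k).map fun x => -x := fun {Z} hZ hZF k => by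
      have hZk : Measurable fun ω => Z ω k := (measurable_pi_apply k).comp hZ
      rw [← hZF k, Measure.map_map measurable_neg hZk]
      rfl
    have hneg : CounterMonotonic P fun ω => -X ω := fun k l hkl => (hCM k l hkl).neg
    have hJMneg : JointMix P fun ω => -Y ω := by
      obtain ⟨c, hc⟩ := hJM
      refine ⟨-c, hc.mono fun ω hω => ?_⟩
      simp [hω]
    refine TwoPointCondition.of_map_neg (twoPointCondition_of_ae_disjoint hX.neg (hmap hX hXF) hneg
      hY.neg (hmap hY hYF) hJMneg (fun a b => ?_) hji.symm hs.neg.isCut ht.neg.isCut ?_ ⟨i, ?_⟩)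
    · obtain ⟨k, hka, hkb, hk⟩ := hnd a b
      obtain ⟨u, hu⟩ := hcut k hk
      exact ⟨k, hka, hkb, -u, hu.neg.isCut⟩
    · filter_upwards [h] with ω hω
      simp only [Pi.neg_apply, neg_lt_neg_iff]
      rintro ⟨h1, h2⟩
      rcases hω with hω | hω
      · exact lt_asymm h1 hω
      · exact lt_asymm h2 hω
    · rintro ⟨x, hx⟩
      refine hi ⟨-x, ?_⟩
      rw [← map_neg_map_neg (F i), hx, Measure.map_dirac]

end ThreeNondegenerate

/-! ### Assembling the characterization -/

section Supports

variable {n : ℕ} {F : Fin n → Measure ℝ}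

theorem TwoPointCondition.counterMonotonic_iff_jointMix [IsProbabilityMeasure P]
    (h : TwoPointCondition F) {X : Ω → Fin n → ℝ} (hX : Measurable X) (hXF : P.map X ∈ frechetClass P F) :
    CounterMonotonic P X ↔ JointMix P X := by
  obtain ⟨a, m, p, hp, hF⟩ := h
  exact counterMonotonic_iff_jointMix_of_twoPoint hX hp fun i =>
    ((map_mem_frechetClass_iff hX).1 hXF i).trans (hF i)

theorem TwoPointCondition.supports [IsProbabilityMeasure P] (hP : Atomless P) (h : TwoPointCondition F) :
    SupportsCounterMonotonicity P F ∧ SupportsJointMix P F := by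
  have h' := h
  obtain ⟨a, m, p, hp, hF⟩ := h
  obtain ⟨X, hX, hXF, hJM⟩ := hP.exists_map_eq_twoPoint a m hp
  have hmem : P.map X ∈ frechetClass P F :=
    (map_mem_frechetClass_iff hX).2 fun i => (hXF i).trans (hF i).symm
  exact ⟨⟨X, hX, hmem, (h'.counterMonotonic_iff_jointMix hX hmem).2 hJM⟩, X, hX, hmem, hJM⟩

theorem SymmetricDegenerateCondition.supports [IsProbabilityMeasure P]
    [∀ i, IsProbabilityMeasure (F i)] (hP : Atomless P)
    (h : SymmetricDegenerateCondition F) :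
    SupportsCounterMonotonicity P F ∧ SupportsJointMix P F := by
  obtain ⟨X, hX, hXF, hJM⟩ := h.exists_jointMix hP
  have hmem := (map_mem_frechetClass_iff hX).2 hXF
  exact ⟨⟨X, hX, hmem, (counterMonotonic_iff_jointMix_of_symmetricDegenerate hX hXF h).2 hJM⟩,
    X, hX, hmem, hJM⟩

theorem twoPointCondition_of_supports [IsProbabilityMeasure P]
    (hCM : SupportsCounterMonotonicity P F) (hJM : SupportsJointMix P F) (h3 : 3 ≤ numNondegenerate F) : TwoPointCondition F := by
  obtain ⟨X, hX, hXF, hXCM⟩ := hCM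
  obtain ⟨Y, hY, hYF, hYJM⟩ := hJM
  exact twoPointCondition_of_counterMonotonic_of_jointMix hX ((map_mem_frechetClass_iff hX).1 hXF)
    hXCM hY ((map_mem_frechetClass_iff hY).1 hYF) hYJM h3

theorem exists_pair_of_numNondegenerate_le_two (hn : 2 ≤ n) (h : numNondegenerate F ≤ 2) :
    ∃ i j : Fin n, i ≠ j ∧ ∀ k, k ≠ i → k ≠ j → Degenerate (F k) := by
  -- With fewer than two non-degenerate indices, the set is padded to exactly two, which needs `2 ≤
  -- n`.
  obtain ⟨T, hT, hcard⟩ := exists_superset_subset_encard_eq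
    (subset_univ {i | ¬ Degenerate (F i)}) (k := 2)
    (by rw [← Set.Finite.cast_ncard_eq (toFinite _)]; exact_mod_cast h)
    (by simpa using hn)
  obtain ⟨i, j, hij, rfl⟩ := encard_eq_two.1 hcard.2
  refine ⟨i, j, hij, fun k hki hkj => ?_⟩
  by_contra hk
  rcases hT hk with rfl | rfl
  · exact hki rfl
  · exact hkj rfl

theorem symmetricDegenerateCondition_of_supports (hn : 2 ≤ n) (hJM : SupportsJointMix P F)
    (h : numNondegenerate F ≤ 2) : SymmetricDegenerateCondition F := by
  obtain ⟨i, j, hij, hdeg⟩ := exists_pair_of_numNondegenerate_le_two hn h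
  obtain ⟨Y, hY, hYF, hYJM⟩ := hJM
  exact ⟨i, j, hij,
    symmetricPair_of_jointMix hY ((map_mem_frechetClass_iff hY).1 hYF) hij hdeg hYJM, hdeg⟩

end Supports

end FrechetClasses

theorem theorem4 {Ω : Type*} [MeasurableSpace Ω] (P : Measure Ω) [IsProbabilityMeasure P]
    (hP : FrechetClasses.Atomless P) (n : ℕ) (hn : 2 ≤ n)
    (F : Fin n → Measure ℝ) [∀ i, IsProbabilityMeasure (F i)] :
    -- the characterization
    ((FrechetClasses.SupportsCounterMonotonicity P F ∧ FrechetClasses.SupportsJointMix P F) ↔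
      (FrechetClasses.TwoPointCondition F ∨ FrechetClasses.SymmetricDegenerateCondition F)) ∧
    -- which of the two conditions is the relevant one
    (3 ≤ FrechetClasses.numNondegenerate F →
      ((FrechetClasses.SupportsCounterMonotonicity P F ∧ FrechetClasses.SupportsJointMix P F) ↔
        FrechetClasses.TwoPointCondition F)) ∧
    (FrechetClasses.numNondegenerate F ≤ 2 →
      ((FrechetClasses.SupportsCounterMonotonicity P F ∧ FrechetClasses.SupportsJointMix P F) ↔
        FrechetClasses.SymmetricDegenerateCondition F)) ∧
    -- equivalence of the two notions within the class
    (FrechetClasses.SupportsCounterMonotonicity P F → FrechetClasses.SupportsJointMix P F →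
      ∀ X : Ω → Fin n → ℝ, Measurable X → P.map X ∈ FrechetClasses.frechetClass P F →
        (FrechetClasses.CounterMonotonic P X ↔ FrechetClasses.JointMix P X)) := by
  have hfwd : FrechetClasses.SupportsCounterMonotonicity P F ∧
      FrechetClasses.SupportsJointMix P F →
      FrechetClasses.TwoPointCondition F ∨ FrechetClasses.SymmetricDegenerateCondition F :=
    fun h => (le_or_gt 3 (FrechetClasses.numNondegenerate F)).imp
      (FrechetClasses.twoPointCondition_of_supports h.1 h.2)
      fun h2 => FrechetClasses.symmetricDegenerateCondition_of_supports hn h.2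
        (Nat.le_of_lt_succ h2)
  refine ⟨⟨hfwd, fun h => h.elim (·.supports hP) (·.supports hP)⟩, fun h3 => ?_, fun h2 => ?_, ?_⟩
  · exact ⟨fun h => FrechetClasses.twoPointCondition_of_supports h.1 h.2 h3, (·.supports hP)⟩
  · exact ⟨fun h => FrechetClasses.symmetricDegenerateCondition_of_supports hn h.2 h2,
      (·.supports hP)⟩
  · intro hCM hJM X hX hXF
    rcases hfwd ⟨hCM, hJM⟩ with h | h
    · exact h.counterMonotonic_iff_jointMix hX hXF
    · exact FrechetClasses.counterMonotonic_iff_jointMix_of_symmetricDegenerate hX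
        ((FrechetClasses.map_mem_frechetClass_iff hX).1 hXF) h
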